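/- Let $\mathcal A$ be a finite alphabet with at least two letters, let $T$ be the left shift on $\mathcal A^{\mathbb Z}$ (with the product topology), and let $d_\beta$, $\beta>1$, be a Cantor metric: $d_\beta(x,y)=\beta^{-j}$ with $j=\min\{|\ell| : x_\ell\neq y_\ell\}$ for $x\ne y$, and $d_\beta(x,x)=0$. For a closed set $X\subseteq\mathcal A^{\mathbb Z}$ with $T(X)=X$ (a subshift), $\delta>0$ and $\nu\in(0,1]$, let $\mathrm{Sep}_X(\delta,\nu)\in\mathbb N\cup\{\infty\}$ be the largest cardinality of a set $S\subseteq X$ such that for all distinct $x,y\in S$ $$\limsup_{n\to\infty}\frac{\#\{\ell\in[-n,n]\cap\mathbb Z : d_\beta(T^\ell x,T^\ell y)\ge\delta\}}{2n+1}\ \ge\ \nu .$$ The lower and upper amorphic complexities of $X$ are $$\underline{\mathrm{ac}}(X)=\sup_{\delta>0}\liminf_{\nu\to0}\frac{\log \mathrm{Sep}_X(\delta,\nu)}{-\log\nu},\qquad \overline{\mathrm{ac}}(X)=\sup_{\delta>0}\limsup_{\nu\to0}\frac{\log \mathrm{Sep}_X(\delta,\nu)}{-\log\nu}$$ (in $[0,\infty]$);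 if they coincide, their common value is the amorphic complexity $\mathrm{ac}(X)$. A substitution $\varphi$ over a finite alphabet $\mathcal B$ assigns to each letter a finite word over $\mathcal B$; it is of constant length $k$ if all these words have length $k$, and primitive if its incidence matrix (whose entry at $(a,b)$ is the number of occurrences of $a$ in $\varphi(b)$) has a power with all entries positive. Let $X_\varphi\subseteq\mathcal B^{\mathbb Z}$ be the set of all sequences each of whose finite words appears in $\varphi^n(b)$ for some $b\in\mathcal B$, $n\ge0$. An automatic system over $\mathcal A$ is a set $X=\tau(X_\varphi)\subseteq\mathcal A^{\mathbb Z}$, where $\varphi$ is a substitution of some constant length $k\ge2$ over some finite alphabet $\mathcal B$ and $\tau:\mathcal B\to\mathcal A$ is a map applied letter by letter. It is minimal if it is a nonempty subshift that contains no nonempty proper subset that is a subshift. Then the real numbers $s\ge1$ such that $s=\mathrm{ac}(X)$ for some minimal automatic system $X$ over $\mathcal A$ form a dense subset of $[1,\infty)$. This already holds for the minimal automatic systems of the form $X_\varphi$ with $\varphi$ a primitive substitution of constant length $k\ge 2$ over $\mathcal A$: the real numbers $s\ge 1$ such that $s=\mathrm{ac}(X_\varphi)$ for such a $\varphi$ are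 dense in $[1,\infty)$. -/

import Mathlib

universe u

noncomputable section

/-! ### Separation numbers and amorphic complexity

The following definitions concern a bijection `f` of a set `Y`, a distance function `d` on `Y`
and an `f`-invariant subset `X` of `Y`; they describe the system `(X, f)` with the metric `d`. -/

/-- The upper density of a set of integers along the intervals `[-n, n]`. -/
def upperDensity (E : Set ℤ) : ℝ :=
  Filter.limsup
    (fun n : ℕ => ((E ∩ Set.Icc (-(n : ℤ)) (n : ℤ)).ncard : ℝ) / (2 * (n : ℝ) + 1)) Filter.atTop

/-- The set of times at which the orbits of `x` and `y` are at least `δ` apart. -/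
def separationTimes {Y : Type u} (d : Y → Y → ℝ) (f : Equiv.Perm Y) (δ : ℝ) (x y : Y) : Set ℤ :=
  {l : ℤ | δ ≤ d ((f ^ l) x) ((f ^ l) y)}

/-- `S` is an `(f, δ, ν)`-separated set. -/
def IsAsympSeparated {Y : Type u} (d : Y → Y → ℝ) (f : Equiv.Perm Y) (δ ν : ℝ) (S : Set Y) :
    Prop :=
  ∀ x ∈ S, ∀ y ∈ S, x ≠ y → ν ≤ upperDensity (separationTimes d f δ x y)

/-- The asymptotic separation number `Sep(f, δ, ν)` of `(X, f)`: the largest cardinality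
(possibly infinite) of an `(f, δ, ν)`-separated subset of `X`. -/
def sepNumber {Y : Type u} (d : Y → Y → ℝ) (f : Equiv.Perm Y) (X : Set Y) (δ ν : ℝ) : ℕ∞ :=
  ⨆ S : {S : Set Y // S ⊆ X ∧ IsAsympSeparated d f δ ν S}, (S : Set Y).encard

/-- The quotient `log Sep(f, δ, ν) / (- log ν)`, which is `∞` if `Sep(f, δ, ν) = ∞`
(for `0 < ν < 1`). -/
def sepRate {Y : Type u} (d : Y → Y → ℝ) (f : Equiv.Perm Y) (X : Set Y) (δ ν : ℝ) : EReal :=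
  ENNReal.log (sepNumber d f X δ ν : ENNReal) / ((-Real.log ν : ℝ) : EReal)

/-- The lower amorphic complexity of `(X, f)`. -/
def lowerAC {Y : Type u} (d : Y → Y → ℝ) (f : Equiv.Perm Y) (X : Set Y) : EReal :=
  ⨆ δ : {δ : ℝ // 0 < δ},
    Filter.liminf (fun ν : ℝ => sepRate d f X δ ν) (nhdsWithin 0 (Set.Ioi 0))

/-- The upper amorphic complexity of `(X, f)`. -/
def upperAC {Y : Type u} (d : Y → Y → ℝ) (f : Equiv.Perm Y) (X : Set Y) : EReal :=
  ⨆ δ : {δ : ℝ // 0 < δ},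
    Filter.limsup (fun ν : ℝ => sepRate d f X δ ν) (nhdsWithin 0 (Set.Ioi 0))

/-- The amorphic complexity of `(X, f)` exists and is equal to `a`. -/
def HasAC {Y : Type u} (d : Y → Y → ℝ) (f : Equiv.Perm Y) (X : Set Y) (a : EReal) : Prop :=
  lowerAC d f X = a ∧ upperAC d f X = a

/-! ### Subshifts -/

/-- The left shift on bi-infinite sequences. -/
def shift (A : Type u) : Equiv.Perm (ℤ → A) where
  toFun x := fun n => x (n + 1)
  invFun x := fun n => x (n - 1)
  left_inv x := by funext n; simp
  right_inv x := by funext n; simp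

open Classical in
/-- The Cantor metric `d_β`: `d_β(x, y) = β ^ (-j)` with `j` the least `|l|` such that
`x l ≠ y l`, and `d_β(x, x) = 0`. -/
def cantorDist {A : Type u} (β : ℝ) (x y : ℤ → A) : ℝ :=
  if x = y then 0 else (β ^ sInf {j : ℕ | ∃ l : ℤ, l.natAbs = j ∧ x l ≠ y l})⁻¹

/-- `X` is a subshift: a closed subset of `A ^ ℤ` with `T(X) = X`. -/
def IsShiftInvariant {A : Type u} [TopologicalSpace A] (X : Set (ℤ → A)) : Prop :=
  IsClosed X ∧ shift A '' X = X

/-- `X` is a (nonempty) minimal subshift. -/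
def IsMinimalSubshift {A : Type u} [TopologicalSpace A] (X : Set (ℤ → A)) : Prop :=
  X.Nonempty ∧ IsShiftInvariant X ∧
    ∀ E : Set (ℤ → A), E ⊆ X → E.Nonempty → IsShiftInvariant E → E = X

/-! ### Substitutions -/

/-- The extension of a substitution to finite words, by concatenation. -/
def substWord {A : Type u} (φ : A → List A) (w : List A) : List A :=
  w.flatMap φ

/-- `φ` is of constant length `k`. -/
def IsConstantLength {A : Type u} (φ : A → List A) (k : ℕ) : Prop :=
  ∀ a, (φ a).length = k

/-- The incidence matrix of `φ`; its entry at `(a, b)` is the number of occurrences of `a` in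
`φ b`. -/
def incidenceMatrix {A : Type u} [DecidableEq A] (φ : A → List A) : Matrix A A ℤ :=
  Matrix.of fun a b => ((φ b).count a : ℤ)

/-- `φ` is primitive: its incidence matrix is primitive. -/
def IsPrimitiveSubst {A : Type u} [Fintype A] [DecidableEq A] (φ : A → List A) : Prop :=
  (incidenceMatrix φ).IsPrimitive

/-- The subshift `X_φ`: all sequences each of whose finite words `x_i ⋯ x_{i+m-1}` appears in
`φⁿ(a)` for some letter `a` and some `n ≥ 0`. -/
def substSystem {A : Type u} (φ : A → List A) : Set (ℤ → A) :=
  {x | ∀ (i : ℤ) (m : ℕ), ∃ (a : A) (n : ℕ),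
    List.ofFn (fun j : Fin m => x (i + (j : ℕ))) <:+: (substWord φ)^[n] [a]}

/-- `X` is an automatic system over the alphabet `A`: the image `τ(X_φ)` under a coding
`τ : B → A` of the subshift of a substitution `φ` of some constant length `k ≥ 2` over some
finite alphabet `B`. -/
def IsAutomaticSystem {A : Type u} (X : Set (ℤ → A)) : Prop :=
  ∃ (B : Type u) (_ : Finite B) (k : ℕ) (φ : B → List B) (τ : B → A),
    2 ≤ k ∧ IsConstantLength φ k ∧ X = (fun x : ℤ → B => τ ∘ x) '' substSystem φ

end

/-! Use a Toeplitz-type substitution of length `k`: positions `1, …, h` of the image of `a` copy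
`a`, and every other position `j` carries a fixed letter `c j`. After `v` iterations only the
positions whose `v` lowest base-`k` digits all lie in `[1, h]` (the holes) still depend on the
argument. They form `h ^ v` residue classes modulo `k ^ v`, hence have density `(h / k) ^ v`.

Upper bound: every point of the system agrees off the holes with a translate of one fixed point,
determined by a residue modulo `k ^ v` (`exists_residue`). Two points with the same residue are
separated only near holes, so once a constant times `(h / k) ^ v` is below `ν`, a separated set has
at most `k ^ v` elements (`sepNumber_le`).

Lower bound: the translates of the fixed point by `0, …, k ^ v - 1` are pairwise separated with
density at least `(h / k) ^ v / k` (`le_sepNumber`). On the holes of level `u`, two translates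
differing by `k ^ u * q` with `k ∤ q` look like the fixed point and its translate by `q`, and these
differ on a whole residue class modulo `k`, provided that `c 0` differs from `c j` for `h < j < k`.

Both bounds give amorphic complexity `log k / (log k - log h)` (`hasAC_holeSubst`). With `h` about
`k ^ (1 - 1 / s)` and `k → ∞` this tends to `s` (`exists_parameters`). The alphabet stays fixed
because only the choice of `c` involves it. -/

noncomputable section

/-! ### Hole substitutions and the arithmetic of their iterates -/

section HoleSubstitution

variable {A : Type u}

/-- The word `y_i ⋯ y_{i+m-1}`. -/
def word (y : ℤ → A) (i : ℤ) (m : ℕ) : List A :=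
  List.ofFn fun j : Fin m => y (i + (j : ℕ))

theorem word_add (y : ℤ → A) (i : ℤ) (m n : ℕ) :
    word y i (m + n) = word y i m ++ word y (i + m) n := by
  simp only [word, List.ofFn_add]
  simp [add_assoc]

theorem word_length (y : ℤ → A) (i : ℤ) (m : ℕ) : (word y i m).length = m := by simp [word]

theorem word_congr {y z : ℤ → A} {i j : ℤ} {m : ℕ}
    (h : ∀ t : ℕ, t < m → y (i + t) = z (j + t)) : word y i m = word z j m := by
  simp only [word]
  congr 1
  funext t
  exact h t t.2

theorem word_inj {y z : ℤ → A} {i j : ℤ} {m : ℕ} (h : word y i m = word z j m) (t : ℕ)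
    (ht : t < m) : y (i + t) = z (j + t) :=
  congrFun (List.ofFn_injective h) ⟨t, ht⟩

theorem word_infix (y : ℤ → A) (i : ℤ) (p m q : ℕ) :
    word y (i + p) m <:+: word y i (p + m + q) := by
  rw [word_add, word_add]
  exact ⟨_, _, rfl⟩

theorem exists_of_infix_word {y : ℤ → A} {i : ℤ} {n : ℕ} {w : List A} (h : w <:+: word y i n) :
    ∃ p : ℕ, p + w.length ≤ n ∧ w = word y (i + p) w.length := by
  obtain ⟨s, t, hst⟩ := h
  have hlen := congrArg List.length hst
  simp only [List.length_append, word_length] at hlen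
  refine ⟨s.length, by omega, ?_⟩
  subst hlen
  rw [word_add, word_add] at hst
  have h1 := List.append_inj hst (by simp [word_length])
  exact (List.append_inj h1.1 (by simp [word_length])).2

/-- The substitution of length `k` with `φ(a)_j = a` for `1 ≤ j ≤ h` and `φ(a)_j = c_j` for the
remaining `j`. -/
def holeSubst (k h : ℕ) (c : ℤ → A) (a : A) : List A :=
  List.ofFn fun j : Fin k => if 1 ≤ (j : ℕ) ∧ (j : ℕ) ≤ h then a else c (j : ℕ)

/-- The action of `holeSubst` on bi-infinite sequences. -/
def inflate (k h : ℕ) (c : ℤ → A) (y : ℤ → A) : ℤ → A := fun n =>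
  if 1 ≤ n % k ∧ n % k ≤ h then y (n / k) else c (n % k)

/-- The positions that the `v`-th iterate of `inflate` does not determine. -/
def IsHole (k h : ℕ) : ℕ → ℤ → Prop
  | 0, _ => True
  | v + 1, n => (1 ≤ n % k ∧ n % k ≤ h) ∧ IsHole k h v (n / k)

variable {k h : ℕ} {c : ℤ → A}

/-- This passes from lists to bi-infinite sequences: afterwards iterates of the substitution are
studied through division with remainder on the index. -/
theorem substWord_word (hk : 0 < k) (y : ℤ → A) (i : ℤ) (m : ℕ) :
    substWord (holeSubst k h c) (word y i m) = word (inflate k h c y) (k * i) (k * m) := by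
  have hone : ∀ i : ℤ, holeSubst k h c (y i) = word (inflate k h c y) (k * i) k := by
    intro i
    simp only [holeSubst, word, inflate]
    congr 1
    funext j
    have hj : ((j : ℕ) : ℤ) < k := by exact_mod_cast j.2
    have h1 : ((k : ℤ) * i + (j : ℕ)) % k = (j : ℕ) := by
      rw [Int.mul_add_emod_self_left, Int.emod_eq_of_lt (by positivity) hj]
    have h2 : ((k : ℤ) * i + (j : ℕ)) / k = i := by
      rw [Int.mul_add_ediv_left _ _ (by positivity), Int.ediv_eq_zero_of_lt (by positivity) hj,
        add_zero]
    rw [h1, h2]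
    norm_cast
  induction m with
  | zero => simp [word, substWord]
  | succ m ih =>
    have h1 : word y (i + m) 1 = [y (i + m)] := by simp [word]
    rw [word_add, Nat.mul_add, word_add, ← ih, h1]
    simp only [substWord, List.flatMap_append, List.flatMap_cons, List.flatMap_nil, List.append_nil,
      hone, mul_one, mul_add]
    push_cast
    rfl

theorem iterate_substWord_word (hk : 0 < k) (y : ℤ → A) (i : ℤ) (m n : ℕ) :
    (substWord (holeSubst k h c))^[n] (word y i m) =
      word ((inflate k h c)^[n] y) ((k : ℤ) ^ n * i) (k ^ n * m) := by
  induction n with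
  | zero => simp
  | succ n ih =>
    rw [Function.iterate_succ_apply', ih, substWord_word hk, Function.iterate_succ_apply']
    congr 1 <;> ring

theorem iterate_substWord_singleton (hk : 0 < k) (a : A) (n : ℕ) :
    (substWord (holeSubst k h c))^[n] [a] =
      word ((inflate k h c)^[n] fun _ => a) 0 (k ^ n) := by
  have := iterate_substWord_word (h := h) (c := c) hk (fun _ => a) 0 1 n
  simpa [word] using this

theorem mem_substSystem_iff (hk : 0 < k) (x : ℤ → A) :
    x ∈ substSystem (holeSubst k h c) ↔ ∀ (i : ℤ) (m : ℕ), ∃ (a : A) (n p : ℕ),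
      p + m ≤ k ^ n ∧ ∀ t : ℕ, t < m → x (i + t) = (inflate k h c)^[n] (fun _ => a) (p + t) := by
  simp only [substSystem, Set.mem_ofPred_eq, iterate_substWord_singleton hk]
  refine forall_congr' fun i => forall_congr' fun m => exists_congr fun a => exists_congr fun n => ?_
  constructor
  · intro hw
    obtain ⟨p, hp, hpw⟩ := exists_of_infix_word hw
    simp only [List.length_ofFn] at hp hpw
    refine ⟨p, hp, fun t ht => ?_⟩
    have := word_inj (y := x) (i := i) hpw t ht
    simpa using this
  · rintro ⟨p, hp, hx⟩
    obtain ⟨q, hq⟩ := Nat.exists_eq_add_of_le hp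
    have h1 : word x i m = word ((inflate k h c)^[n] fun _ => a) (0 + p) m :=
      word_congr (by simpa using hx)
    change word x i m <:+: _
    rw [h1, hq]
    exact word_infix _ _ _ _ _

/-! ### Iterates of the inflation -/

theorem inflate_shift (hk : 0 < k) (y : ℤ → A) (m n : ℤ) :
    inflate k h c y (n + k * m) = inflate k h c (fun l => y (l + m)) n := by
  have hk' : (k : ℤ) ≠ 0 := by positivity
  simp [inflate, Int.add_mul_ediv_left _ _ hk']

theorem iterate_inflate_shift (hk : 0 < k) (v : ℕ) (y : ℤ → A) (m n : ℤ) :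
    (inflate k h c)^[v] y (n + (k : ℤ) ^ v * m) =
      (inflate k h c)^[v] (fun l => y (l + m)) n := by
  induction v generalizing y m with
  | zero => simp
  | succ v ih =>
    rw [Function.iterate_succ_apply, Function.iterate_succ_apply, pow_succ, mul_assoc, ih]
    exact congrArg (fun z => (inflate k h c)^[v] z n) (funext fun l => inflate_shift hk y m l)

theorem ediv_ediv_pow (n : ℤ) (v : ℕ) : n / (k : ℤ) / (k : ℤ) ^ v = n / (k : ℤ) ^ (v + 1) := by
  rw [Int.ediv_ediv_of_nonneg (by positivity), pow_succ']

theorem iterate_inflate_of_isHole (v : ℕ) (y : ℤ → A) (n : ℤ) (hn : IsHole k h v n) :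
    (inflate k h c)^[v] y n = y (n / (k : ℤ) ^ v) := by
  induction v generalizing n with
  | zero => simp
  | succ v ih =>
    rw [Function.iterate_succ_apply', inflate, if_pos hn.1, ih _ hn.2, ediv_ediv_pow]

theorem iterate_inflate_of_not_isHole (v : ℕ) (y z : ℤ → A) (n : ℤ) (hn : ¬ IsHole k h v n) :
    (inflate k h c)^[v] y n = (inflate k h c)^[v] z n := by
  induction v generalizing n with
  | zero => exact absurd trivial hn
  | succ v ih =>
    rw [Function.iterate_succ_apply', Function.iterate_succ_apply', inflate, inflate]
    split_ifs with hc
    · exact ih _ fun h' => hn ⟨hc, h'⟩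
    · rfl

theorem iterate_inflate_congr (v : ℕ) (y z : ℤ → A) (n : ℤ)
    (hn : y (n / (k : ℤ) ^ v) = z (n / (k : ℤ) ^ v)) :
    (inflate k h c)^[v] y n = (inflate k h c)^[v] z n := by
  by_cases hh : IsHole k h v n
  · rw [iterate_inflate_of_isHole v y n hh, iterate_inflate_of_isHole v z n hh, hn]
  · exact iterate_inflate_of_not_isHole v y z n hh

theorem isHole_add_pow_mul (hk : 0 < k) (v : ℕ) (n m : ℤ) :
    IsHole k h v (n + (k : ℤ) ^ v * m) ↔ IsHole k h v n := by
  have hk' : (k : ℤ) ≠ 0 := by positivity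
  induction v generalizing n with
  | zero => simp [IsHole]
  | succ v ih =>
    have h1 : n + (k : ℤ) ^ (v + 1) * m = n + k * ((k : ℤ) ^ v * m) := by ring
    simp only [IsHole]
    rw [h1, Int.add_mul_emod_self_left, Int.add_mul_ediv_left _ _ hk']
    exact and_congr_right fun _ => ih _

theorem isHole_emod (hk : 0 < k) (v : ℕ) (n : ℤ) :
    IsHole k h v (n % (k : ℤ) ^ v) ↔ IsHole k h v n := by
  conv_rhs => rw [← Int.emod_add_mul_ediv n ((k : ℤ) ^ v)]
  rw [isHole_add_pow_mul hk]

/-- The residues of the positions not determined by the `v`-th iterate of `inflate`. -/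
def holeResidues (k h : ℕ) : ℕ → Finset ℤ
  | 0 => {0}
  | v + 1 => (Finset.Icc (1 : ℤ) h ×ˢ holeResidues k h v).image fun p => p.1 + k * p.2

theorem emod_ediv_of_digit {j m : ℤ} (h0 : 0 ≤ j) (hj : j < k) :
    (j + k * m) % k = j ∧ (j + k * m) / k = m := by
  have hk' : (k : ℤ) ≠ 0 := by omega
  rw [Int.add_mul_emod_self_left, Int.add_mul_ediv_left _ _ hk', Int.emod_eq_of_lt h0 hj,
    Int.ediv_eq_zero_of_lt h0 hj, zero_add]
  exact ⟨rfl, rfl⟩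

theorem mem_holeResidues (hhk : h < k) (v : ℕ) (n : ℤ) :
    n ∈ holeResidues k h v ↔ (0 ≤ n ∧ n < (k : ℤ) ^ v) ∧ IsHole k h v n := by
  have hk0 : (0 : ℤ) < k := by omega
  induction v generalizing n with
  | zero => simp [holeResidues, IsHole]; omega
  | succ v ih =>
    simp only [holeResidues, Finset.mem_image, Finset.mem_product, Finset.mem_Icc, IsHole,
      Prod.exists, ih]
    constructor
    · rintro ⟨j, m, ⟨⟨hj1, hj2⟩, ⟨hm0, hm1⟩, hm⟩, rfl⟩
      obtain ⟨e1, e2⟩ := emod_ediv_of_digit (k := k) (j := j) (m := m) (by omega) (by omega)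
      rw [e1, e2]
      refine ⟨⟨by positivity, ?_⟩, ⟨hj1, hj2⟩, hm⟩
      have : (k : ℤ) * (m + 1) ≤ k * k ^ v := by gcongr; omega
      rw [pow_succ']
      have h3 : j < k := by omega
      linarith
    · rintro ⟨⟨hn0, hn1⟩, hn, hm⟩
      refine ⟨n % k, n / k, ⟨hn, ⟨Int.ediv_nonneg hn0 hk0.le, ?_⟩, hm⟩, Int.emod_add_mul_ediv n k⟩
      exact Int.ediv_lt_of_lt_mul hk0 (by rwa [← pow_succ])

theorem card_holeResidues (hhk : h < k) (v : ℕ) : (holeResidues k h v).card = h ^ v := by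
  induction v with
  | zero => simp [holeResidues]
  | succ v ih =>
    rw [holeResidues, Finset.card_image_of_injOn, Finset.card_product, ih, pow_succ']
    · simp
    · rintro ⟨j, m⟩ hp ⟨j', m'⟩ hp' heq
      simp only [Finset.coe_product, Set.mem_prod, Finset.mem_coe, Finset.mem_Icc] at hp hp' heq
      obtain ⟨e1, e2⟩ := emod_ediv_of_digit (k := k) (j := j) (m := m) (by omega) (by omega)
      obtain ⟨e1', e2'⟩ := emod_ediv_of_digit (k := k) (j := j') (m := m') (by omega) (by omega)
      rw [heq] at e1 e2
      rw [← e1, ← e2, e1', e2']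

/-! ### The fixed point of the inflation -/

/-- Floor division by `k` fixes only `0` and `-1`, whose residues `0` and `k - 1` are not copying
positions. This makes the recursion for `fixedSeq` well founded on both half-lines. -/
theorem natAbs_ediv_lt (hhk : 2 * h < k) {n : ℤ} (hn : 1 ≤ n % k ∧ n % k ≤ h) :
    (n / k).natAbs < n.natAbs := by
  have h1 := Int.emod_add_mul_ediv n k
  have hk : (3 : ℤ) ≤ k := by omega
  have h2 : 2 * (n % k) < k := by omega
  generalize n / k = q at *
  rcases le_or_gt 0 q with hq | hq
  · have : q ≤ k * q := by nlinarith
    omega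
  · have : (k : ℤ) * q ≤ q - (k - 1) := by nlinarith
    omega

/-- The bi-infinite fixed point of `inflate`. -/
def fixedSeq (k h : ℕ) (c : ℤ → A) (n : ℤ) : A :=
  if hn : (1 ≤ n % k ∧ n % k ≤ h) ∧ 2 * h < k then fixedSeq k h c (n / k) else c (n % k)
termination_by n.natAbs
decreasing_by exact natAbs_ediv_lt hn.2 hn.1

theorem inflate_fixedSeq (hhk : 2 * h < k) : inflate k h c (fixedSeq k h c) = fixedSeq k h c := by
  funext n
  rw [fixedSeq, inflate]
  simp [hhk]

theorem iterate_inflate_fixedSeq (hhk : 2 * h < k) (v : ℕ) :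
    (inflate k h c)^[v] (fixedSeq k h c) = fixedSeq k h c :=
  Function.iterate_fixed (inflate_fixedSeq hhk) v

theorem fixedSeq_of_not_digit {n : ℤ} (hn : ¬ (1 ≤ n % k ∧ n % k ≤ h)) :
    fixedSeq k h c n = c (n % k) := by
  rw [fixedSeq, dif_neg fun h' => hn h'.1]

theorem fixedSeq_of_isHole (hhk : 2 * h < k) (v : ℕ) (n : ℤ) (hn : IsHole k h v n) :
    fixedSeq k h c n = fixedSeq k h c (n / (k : ℤ) ^ v) := by
  conv_lhs => rw [← iterate_inflate_fixedSeq hhk v, iterate_inflate_of_isHole v _ n hn]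

/-- A window around the origin meets only the level-`n` blocks with indices `-1` and `0`, whose
letters are `c (k - 1)` and `c 0`. These two letters are adjacent in the second iterate of any
letter. -/
theorem fixedSeq_mem (hh : 1 ≤ h) (hhk : 2 * h < k) :
    fixedSeq k h c ∈ substSystem (holeSubst k h c) := by
  have hk : 0 < k := by omega
  rw [mem_substSystem_iff hk]
  intro i m
  obtain ⟨n, hn⟩ : ∃ n : ℕ, i.natAbs + m < k ^ n :=
    ⟨_, Nat.lt_pow_self (by omega : 1 < k)⟩
  have hn' : (i.natAbs : ℤ) + m < (k : ℤ) ^ n := by exact_mod_cast hn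
  have hpow : (k : ℤ) ^ (n + 1) = (k : ℤ) ^ n * k := pow_succ _ _
  have hk3 : (3 : ℤ) ≤ k := by omega
  have hpos : 0 < (k : ℤ) ^ n := by positivity
  have hle : (k : ℤ) ^ n * 3 ≤ (k : ℤ) ^ n * k := by gcongr
  obtain ⟨p, hp⟩ : ∃ p : ℕ, (p : ℤ) = i + (k : ℤ) ^ (n + 1) :=
    ⟨(i + (k : ℤ) ^ (n + 1)).toNat, Int.toNat_of_nonneg (by omega)⟩
  -- The starting letter is arbitrary. Two extra iterations are needed because the adjacent pair
  -- sits at positions `k - 1` and `k`, across the boundary of two images.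
  refine ⟨c 0, n + 2, p, ?_, fun t ht => ?_⟩
  · have h2 : (k : ℤ) ^ (n + 2) = (k : ℤ) ^ (n + 1) * k := pow_succ _ _
    have h3 : (k : ℤ) ^ (n + 1) * 3 ≤ (k : ℤ) ^ (n + 1) * k := by gcongr
    zify
    omega
  · rw [hp, hpow, show i + (k : ℤ) ^ n * k + t = (i + t) + (k : ℤ) ^ n * k by ring,
      Function.iterate_add_apply, iterate_inflate_shift hk]
    conv_lhs => rw [← iterate_inflate_fixedSeq hhk n]
    apply iterate_inflate_congr
    have hcases : (i + t) / (k : ℤ) ^ n = -1 ∨ (i + t) / (k : ℤ) ^ n = 0 := by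
      have h1 : (-1 : ℤ) ≤ (i + t) / (k : ℤ) ^ n := by
        rw [Int.le_ediv_iff_mul_le hpos]; omega
      have h2 : (i + t) / (k : ℤ) ^ n < 1 := by
        rw [Int.ediv_lt_iff_lt_mul hpos]; omega
      omega
    have e1 : (-1 : ℤ) % k = k - 1 := by
      rw [← Int.add_emod_right, Int.emod_eq_of_lt (by omega) (by omega)]; ring
    have e2 : (-1 + (k : ℤ)) % k = k - 1 := by
      rw [Int.emod_eq_of_lt (by omega) (by omega)]; ring
    rcases hcases with hc | hc <;> rw [hc]
    · rw [fixedSeq_of_not_digit (by omega), e1, Function.iterate_succ_apply', inflate,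
        if_neg (by omega), e2]
    · rw [fixedSeq_of_not_digit (by simp), Function.iterate_succ_apply', inflate,
        if_neg (by simp)]
      simp

/-- Up to a translation, the points of the substitution system agree with the fixed point off the
holes. -/
theorem exists_residue (hhk : 2 * h < k) {y : ℤ → A}
    (hy : y ∈ substSystem (holeSubst k h c)) (v : ℕ) :
    ∃ r ∈ Finset.range (k ^ v), ∀ n : ℤ, ¬ IsHole k h v (n + (r : ℕ)) →
      y n = fixedSeq k h c (n + (r : ℕ)) := by
  have hk : 0 < k := by omega
  rw [mem_substSystem_iff hk] at hy
  have hfin : ∀ N : ℕ, ∃ r ∈ Finset.range (k ^ v), ∀ n : ℤ, n.natAbs ≤ N →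
      ¬ IsHole k h v (n + (r : ℕ)) → y n = fixedSeq k h c (n + (r : ℕ)) := by
    intro N
    -- The surplus length `k ^ v` forces `v ≤ n`.
    obtain ⟨a, n, p, hpn, hyn⟩ := hy (-(N : ℤ)) (2 * N + 1 + k ^ v)
    have hvn : v ≤ n := by
      by_contra hlt
      have := Nat.pow_le_pow_right hk (not_le.1 hlt).le
      omega
    obtain ⟨w, rfl⟩ := Nat.exists_eq_add_of_le hvn
    have hrem : (((p + N) % k ^ v : ℕ) : ℤ) + (k : ℤ) ^ v * ((p + N) / k ^ v : ℕ) = p + N := by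
      exact_mod_cast Nat.mod_add_div (p + N) (k ^ v)
    generalize ((p + N) / k ^ v : ℕ) = q at hrem
    refine ⟨(p + N) % k ^ v, Finset.mem_range.2 (Nat.mod_lt _ (by positivity)), fun l hl hhole => ?_⟩
    generalize (p + N) % k ^ v = r at *
    obtain ⟨t, ht⟩ : ∃ t : ℕ, (t : ℤ) = l + N := ⟨(l + N).toNat, Int.toNat_of_nonneg (by omega)⟩
    have h1 := hyn t (by omega)
    rw [show (-(N : ℤ)) + t = l by omega, show (p : ℤ) + t = (l + r) + (k : ℤ) ^ v * q by
      rw [ht]; linear_combination -hrem] at h1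
    rw [h1, Function.iterate_add_apply, iterate_inflate_shift hk]
    conv_rhs => rw [← iterate_inflate_fixedSeq hhk v]
    exact iterate_inflate_of_not_isHole v _ _ _ hhole
  -- Compactness: if each of the finitely many residues failed at some position, a window containing
  -- all these positions would contradict `hfin`.
  by_contra hcon
  push Not at hcon
  choose! f hf hf' using hcon
  obtain ⟨r, hr, hrN⟩ := hfin ((Finset.range (k ^ v)).sup fun r => (f r).natAbs)
  exact hf' r hr (hrN (f r) (Finset.le_sup (f := fun r => (f r).natAbs) hr) (hf r hr))

/-! ### Minimality -/

/-- A word of `x` lies in an iterate of some letter `a = c j`. Since `j` is not a copying position,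
the blocks of `y` with index `j` modulo `k` avoid the holes of level `n + 1`, so each of them is the
`n`-th iterate of `a`. -/
theorem exists_occurrence (hhk : 2 * h < k)
    (hc : ∀ a, ∃ j : ℤ, 0 ≤ j ∧ j < k ∧ ¬ (1 ≤ j ∧ j ≤ h) ∧ c j = a)
    {x y : ℤ → A} (hx : x ∈ substSystem (holeSubst k h c))
    (hy : y ∈ substSystem (holeSubst k h c)) (i : ℤ) (m : ℕ) :
    ∃ s : ℤ, ∀ t : ℕ, t < m → x (i + t) = y (s + t) := by
  have hk : 0 < k := by omega
  obtain ⟨a, n, p, hp, hxn⟩ := (mem_substSystem_iff hk x).1 hx i m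
  obtain ⟨j, hj0, hjk, hj, rfl⟩ := hc a
  obtain ⟨r, -, hr⟩ := exists_residue hhk hy (n + 1)
  refine ⟨p + (k : ℤ) ^ n * j - r, fun t ht => ?_⟩
  have hdiv : ((p : ℤ) + t) / (k : ℤ) ^ n = 0 :=
    Int.ediv_eq_zero_of_lt (by positivity) (by
      have : ((p + m : ℕ) : ℤ) ≤ ((k ^ n : ℕ) : ℤ) := by exact_mod_cast hp
      push_cast at this
      omega)
  have hmod : j % (k : ℤ) = j := Int.emod_eq_of_lt hj0 hjk
  -- One base-`k` digit outside `[1, h]`, here the one at `k ^ n`, already excludes a hole.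
  have hnot : ∀ (n : ℕ) (l : ℤ), ¬ (1 ≤ l / (k : ℤ) ^ n % k ∧ l / (k : ℤ) ^ n % k ≤ h) →
      ¬ IsHole k h (n + 1) l := by
    intro n
    induction n with
    | zero => intro l hl hh; exact hl (by simpa using hh.1)
    | succ n ih =>
      intro l hl hh
      exact ih (l / k) (by rwa [ediv_ediv_pow]) hh.2
  have hpos : (p + (k : ℤ) ^ n * j - r + t) + r = (p + t) + (k : ℤ) ^ n * j := by ring
  rw [hr _ ?_, hpos, hxn t ht]
  · conv_rhs => rw [← iterate_inflate_fixedSeq hhk n]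
    rw [iterate_inflate_shift hk]
    apply iterate_inflate_congr
    rw [hdiv, zero_add, fixedSeq_of_not_digit (by rwa [hmod]), hmod]
  · rw [hpos]
    apply hnot
    rw [Int.add_mul_ediv_left _ _ (by positivity), hdiv, zero_add, hmod]
    exact hj

theorem shift_zpow_apply (l : ℤ) (x : ℤ → A) (n : ℤ) : ((shift A ^ l) x) n = x (n + l) := by
  induction l generalizing n with
  | zero => simp
  | succ l ih =>
    rw [add_comm, zpow_add, zpow_one, Equiv.Perm.mul_apply]
    exact (ih (n + 1)).trans (congrArg x (by ring))
  | pred l ih =>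
    rw [sub_eq_neg_add, zpow_add, zpow_neg_one, Equiv.Perm.mul_apply]
    exact (ih (n - 1)).trans (congrArg x (by ring))

theorem mem_of_locally_mem [TopologicalSpace A] [DiscreteTopology A] {E : Set (ℤ → A)}
    (hE : IsClosed E) {x : ℤ → A}
    (hx : ∀ N : ℕ, ∃ y ∈ E, ∀ n : ℤ, n.natAbs ≤ N → x n = y n) : x ∈ E := by
  choose f hfE hf using hx
  refine hE.mem_of_tendsto (f := f) (b := Filter.atTop) ?_ (Filter.Eventually.of_forall hfE)
  rw [tendsto_pi_nhds]
  intro n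
  refine tendsto_const_nhds.congr' ?_
  filter_upwards [Filter.eventually_ge_atTop n.natAbs] with N hN using hf N n hN

theorem isMinimalSubshift_holeSubst [TopologicalSpace A] [DiscreteTopology A]
    (hh : 1 ≤ h) (hhk : 2 * h < k)
    (hc : ∀ a, ∃ j : ℤ, 0 ≤ j ∧ j < k ∧ ¬ (1 ≤ j ∧ j ≤ h) ∧ c j = a) :
    IsMinimalSubshift (substSystem (holeSubst k h c)) := by
  have hk : 0 < k := by omega
  refine ⟨⟨_, fixedSeq_mem hh hhk⟩, ⟨?_, ?_⟩, ?_⟩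
  · refine isClosed_of_closure_subset fun x hx => ?_
    intro i m
    have hopen : IsOpen {y : ℤ → A | ∀ t : Fin m, y (i + (t : ℕ)) = x (i + (t : ℕ))} := by
      simp only [Set.ofPred_forall]
      refine isOpen_iInter_of_finite fun t => ?_
      exact (isOpen_discrete {x (i + (t : ℕ))}).preimage
        (continuous_apply (A := fun _ : ℤ => A) (i + ((t : ℕ) : ℤ)))
    obtain ⟨y, hyx, hy⟩ := mem_closure_iff.1 hx _ hopen fun _ => rfl
    have := hy i m
    rwa [show (fun j : Fin m => y (i + (j : ℕ))) = fun j : Fin m => x (i + (j : ℕ)) from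
      funext hyx] at this
  · ext x
    constructor
    · rintro ⟨y, hy, rfl⟩ i m
      have := hy (i + 1) m
      simpa [shift, add_right_comm] using this
    · intro hx
      refine ⟨(shift A).symm x, fun i m => ?_, Equiv.apply_symm_apply _ _⟩
      have := hx (i - 1) m
      simpa [shift, add_sub_right_comm] using this
  · rintro E hEX ⟨y, hyE⟩ ⟨hEc, hEs⟩
    refine hEX.antisymm fun x hx => mem_of_locally_mem hEc fun N => ?_
    have hz : ∀ s : ℤ, (shift A ^ s) y ∈ E := by
      have h1 : ∀ z ∈ E, shift A z ∈ E := fun z hz => hEs ▸ ⟨z, hz, rfl⟩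
      have h2 : ∀ z ∈ E, (shift A)⁻¹ z ∈ E := by
        intro z hz
        rw [← hEs] at hz
        obtain ⟨w, hw, rfl⟩ := hz
        simpa using hw
      intro s
      induction s with
      | zero => simpa using hyE
      | succ s ih => rw [add_comm, zpow_add, zpow_one]; exact h1 _ ih
      | pred s ih => rw [sub_eq_neg_add, zpow_add, zpow_neg_one]; exact h2 _ ih
    obtain ⟨s, hs⟩ := exists_occurrence hhk hc hx (hEX hyE) (-(N : ℤ)) (2 * N + 1)
    refine ⟨(shift A ^ (s + N)) y, hz _, fun n hn => ?_⟩
    have := hs (n + N).toNat (by omega)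
    rw [Int.toNat_of_nonneg (by omega)] at this
    rw [shift_zpow_apply]
    convert this using 2 <;> ring

end HoleSubstitution

/-! ### Upper density of sets bounded by unions of residue classes -/

section Density

theorem abs_card_modEq_sub_le {M : ℤ} (hM : 0 < M) (r : ℤ) (n : ℕ) :
    |(((Finset.Icc (-(n : ℤ)) n).filter (· ≡ r [ZMOD M])).card : ℝ) - (2 * n + 1) / M| ≤ 1 := by
  have hIco : Finset.Icc (-(n : ℤ)) n = Finset.Ico (-(n : ℤ)) (n + 1) := by
    ext l; simp
  have h1 := Int.Ico_filter_modEq_card (-(n : ℤ)) (n + 1) hM r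
  have hM' : (0 : ℚ) < M := by exact_mod_cast hM
  have hle : ⌈(((-(n : ℤ)) - r : ℤ) : ℚ) / (M : ℚ)⌉ ≤ ⌈(((n : ℤ) + 1 - r : ℤ) : ℚ) / (M : ℚ)⌉ := by
    apply Int.ceil_mono
    gcongr
    omega
  push_cast at h1 hle
  rw [max_eq_left (by omega)] at h1
  rw [← hIco] at h1
  generalize ((Finset.Icc (-(n : ℤ)) n).filter (· ≡ r [ZMOD M])).card = C at *
  have h2 : (C : ℚ) = (⌈((n : ℚ) + 1 - r) / M⌉ : ℚ) - (⌈(-(n : ℚ) - r) / M⌉ : ℚ) := by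
    exact_mod_cast h1
  have e : ((n : ℚ) + 1 - r) / M - (-(n : ℚ) - r) / M = (2 * n + 1) / M := by
    field_simp; ring
  have a1 := Int.le_ceil (((n : ℚ) + 1 - r) / M)
  have a2 := Int.ceil_lt_add_one (((n : ℚ) + 1 - r) / M)
  have a3 := Int.le_ceil ((-(n : ℚ) - r) / M)
  have a4 := Int.ceil_lt_add_one ((-(n : ℚ) - r) / M)
  have h3 : |(C : ℚ) - (2 * n + 1) / M| ≤ 1 := by
    rw [abs_le, h2]
    constructor <;> linarith
  exact_mod_cast h3

theorem tendsto_density_bound (C M e : ℝ) :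
    Filter.Tendsto (fun n : ℕ => C * ((2 * (n : ℝ) + 1) / M + e) / (2 * (n : ℝ) + 1))
      Filter.atTop (nhds (C / M)) := by
  have h1 : Filter.Tendsto (fun n : ℕ => 2 * (n : ℝ) + 1) Filter.atTop Filter.atTop :=
    Filter.tendsto_atTop_add_const_right _ _
      (tendsto_natCast_atTop_atTop.const_mul_atTop (by norm_num))
  have h2 := (h1.inv_tendsto_atTop.const_mul (C * e)).const_add (C / M)
  rw [mul_zero, add_zero] at h2
  refine h2.congr fun n => ?_
  have : (2 * (n : ℝ) + 1) ≠ 0 := by positivity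
  simp only [Pi.inv_apply]
  field_simp

theorem ncard_inter_Icc_le (E : Set ℤ) (n : ℕ) :
    ((E ∩ Set.Icc (-(n : ℤ)) n).ncard : ℝ) / (2 * (n : ℝ) + 1) ≤ 1 := by
  rw [div_le_one (by positivity)]
  have h1 : (E ∩ Set.Icc (-(n : ℤ)) n).ncard ≤ (Set.Icc (-(n : ℤ)) (n : ℤ)).ncard :=
    Set.ncard_le_ncard Set.inter_subset_right (Set.finite_Icc _ _)
  have h2 : (Set.Icc (-(n : ℤ)) (n : ℤ)).ncard = 2 * n + 1 := by
    rw [← Finset.coe_Icc, Set.ncard_coe_finset, Int.card_Icc]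
    omega
  rw [h2] at h1
  exact_mod_cast h1

theorem isBoundedUnder_ncard_inter_Icc (E : Set ℤ) : Filter.IsBoundedUnder (· ≤ ·) Filter.atTop
    fun n : ℕ => ((E ∩ Set.Icc (-(n : ℤ)) n).ncard : ℝ) / (2 * (n : ℝ) + 1) :=
  Filter.isBoundedUnder_of ⟨1, ncard_inter_Icc_le E⟩

theorem isCoboundedUnder_ncard_inter_Icc (E : Set ℤ) :
    Filter.IsCoboundedUnder (· ≤ ·) Filter.atTop
      fun n : ℕ => ((E ∩ Set.Icc (-(n : ℤ)) n).ncard : ℝ) / (2 * (n : ℝ) + 1) :=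
  Filter.IsBoundedUnder.isCoboundedUnder_le (Filter.isBoundedUnder_of ⟨0, fun n => by positivity⟩)

theorem upperDensity_le_of_subset {ι : Type*} (R : Finset ι) (f : ι → ℤ) {M : ℤ} (hM : 0 < M)
    {E : Set ℤ} (hE : ∀ l ∈ E, ∃ p ∈ R, l ≡ f p [ZMOD M]) :
    upperDensity E ≤ R.card / M := by
  rw [upperDensity, ← (tendsto_density_bound R.card M 1).limsup_eq]
  refine Filter.limsup_le_limsup (Filter.Eventually.of_forall fun n => ?_)
    (isCoboundedUnder_ncard_inter_Icc E) (tendsto_density_bound R.card M 1).isBoundedUnder_le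
  dsimp only
  gcongr
  classical
  have h1 : E ∩ Set.Icc (-(n : ℤ)) n ⊆
      (R.biUnion fun p => (Finset.Icc (-(n : ℤ)) n).filter (· ≡ f p [ZMOD M]) : Finset ℤ) := by
    rintro l ⟨hl, hln⟩
    obtain ⟨p, hp, hlp⟩ := hE l hl
    simp only [Finset.coe_biUnion, Set.mem_iUnion, Finset.mem_coe, Finset.mem_filter,
      Finset.mem_Icc, exists_prop]
    exact ⟨p, hp, hln, hlp⟩
  calc ((E ∩ Set.Icc (-(n : ℤ)) n).ncard : ℝ)
      ≤ ((R.biUnion fun p => (Finset.Icc (-(n : ℤ)) n).filter (· ≡ f p [ZMOD M])).card : ℝ) := by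
        rw [← Set.ncard_coe_finset]
        exact_mod_cast Set.ncard_le_ncard h1 (Finset.finite_toSet _)
    _ ≤ ∑ p ∈ R, (((Finset.Icc (-(n : ℤ)) n).filter (· ≡ f p [ZMOD M])).card : ℝ) := by
        exact_mod_cast Finset.card_biUnion_le
    _ ≤ ∑ _p ∈ R, ((2 * (n : ℝ) + 1) / M + 1) := by
        gcongr with p _
        have := (abs_le.1 (abs_card_modEq_sub_le hM (f p) n)).2
        linarith
    _ = R.card * ((2 * (n : ℝ) + 1) / M + 1) := by rw [Finset.sum_const, nsmul_eq_mul]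

theorem le_upperDensity_of_subset {ι : Type*} (R : Finset ι) (f : ι → ℤ) {M : ℤ} (hM : 0 < M)
    (hf : ∀ p ∈ R, ∀ q ∈ R, f p ≡ f q [ZMOD M] → p = q)
    {E : Set ℤ} (hE : ∀ p ∈ R, ∀ l, l ≡ f p [ZMOD M] → l ∈ E) :
    R.card / M ≤ upperDensity E := by
  rw [upperDensity, ← (tendsto_density_bound R.card M (-1)).limsup_eq]
  refine Filter.limsup_le_limsup (Filter.Eventually.of_forall fun n => ?_)
    (tendsto_density_bound R.card M (-1)).isCoboundedUnder_le (isBoundedUnder_ncard_inter_Icc E)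
  dsimp only
  gcongr
  classical
  have h1 : ((R.biUnion fun p => (Finset.Icc (-(n : ℤ)) n).filter (· ≡ f p [ZMOD M]) :
      Finset ℤ) : Set ℤ) ⊆ E ∩ Set.Icc (-(n : ℤ)) n := by
    intro l hl
    simp only [Finset.coe_biUnion, Set.mem_iUnion, Finset.mem_coe, Finset.mem_filter,
      Finset.mem_Icc, exists_prop] at hl
    obtain ⟨p, hp, hln, hlp⟩ := hl
    exact ⟨hE p hp l hlp, hln⟩
  calc (R.card : ℝ) * ((2 * (n : ℝ) + 1) / M + -1)
      = ∑ _p ∈ R, ((2 * (n : ℝ) + 1) / M + -1) := by rw [Finset.sum_const, nsmul_eq_mul]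
    _ ≤ ∑ p ∈ R, (((Finset.Icc (-(n : ℤ)) n).filter (· ≡ f p [ZMOD M])).card : ℝ) := by
        gcongr with p _
        have := (abs_le.1 (abs_card_modEq_sub_le hM (f p) n)).1
        linarith
    _ = ((R.biUnion fun p => (Finset.Icc (-(n : ℤ)) n).filter (· ≡ f p [ZMOD M])).card : ℝ) := by
        rw [Finset.card_biUnion]
        · push_cast; rfl
        · intro p hp q hq hpq
          rw [Function.onFun, Finset.disjoint_left]
          intro l hl hl'
          rw [Finset.mem_filter] at hl hl'
          exact hpq (hf p hp q hq (hl.2.symm.trans hl'.2))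
    _ ≤ ((E ∩ Set.Icc (-(n : ℤ)) n).ncard : ℝ) := by
        rw [← Set.ncard_coe_finset]
        exact_mod_cast Set.ncard_le_ncard h1 ((Set.finite_Icc _ _).inter_of_right _)

theorem upperDensity_empty : upperDensity ∅ = 0 := by simp [upperDensity]

end Density

/-! ### The Cantor metric and finite windows -/

section CantorDist

variable {A : Type u} {β : ℝ}

theorem cantorDist_comm (x y : ℤ → A) : cantorDist β x y = cantorDist β y x := by
  by_cases hxy : x = y
  · rw [hxy]
  · rw [cantorDist, cantorDist, if_neg hxy, if_neg (Ne.symm hxy)]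
    simp only [ne_comm (a := x _)]

theorem one_le_cantorDist (x y : ℤ → A) (hxy : x 0 ≠ y 0) : 1 ≤ cantorDist β x y := by
  have h0 : sInf {j : ℕ | ∃ l : ℤ, l.natAbs = j ∧ x l ≠ y l} = 0 :=
    Nat.sInf_eq_zero.2 (Or.inl ⟨0, rfl, hxy⟩)
  rw [cantorDist, if_neg fun h => hxy (congrFun h 0), h0]
  simp

theorem exists_radius (hβ : 1 < β) {δ : ℝ} (hδ : 0 < δ) : ∃ R : ℕ, ∀ x y : ℤ → A,
    δ ≤ cantorDist β x y → ∃ l : ℤ, l.natAbs ≤ R ∧ x l ≠ y l := by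
  obtain ⟨R, hR⟩ := pow_unbounded_of_one_lt δ⁻¹ hβ
  refine ⟨R, fun x y hd => ?_⟩
  have hne : x ≠ y := by
    rintro rfl
    rw [cantorDist, if_pos rfl] at hd
    exact hδ.not_ge hd
  rw [cantorDist, if_neg hne] at hd
  have hmem : sInf {j : ℕ | ∃ l : ℤ, l.natAbs = j ∧ x l ≠ y l} ∈
      {j : ℕ | ∃ l : ℤ, l.natAbs = j ∧ x l ≠ y l} := by
    obtain ⟨l, hl⟩ := Function.ne_iff.1 hne
    exact Nat.sInf_mem ⟨_, l, rfl, hl⟩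
  generalize sInf {j : ℕ | ∃ l : ℤ, l.natAbs = j ∧ x l ≠ y l} = j at *
  obtain ⟨l, hl, hxy⟩ := hmem
  refine ⟨l, ?_, hxy⟩
  rw [hl]
  have hlt : β ^ j < β ^ R := by
    have h1 := inv_anti₀ hδ hd
    rw [inv_inv] at h1
    exact h1.trans_lt hR
  exact ((pow_lt_pow_iff_right₀ hβ).1 hlt).le

end CantorDist

/-! ### Upper and lower bounds for the separation numbers -/

section Separation

variable {A : Type u} {β : ℝ} {k h : ℕ} {c : ℤ → A}

/-- At a separation time some coordinate within distance `R` is a hole, so these times lie in the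
union of `2 * R + 1` translates of the hole set. -/
theorem upperDensity_separationTimes_le (hhk : 2 * h < k) {δ : ℝ} {R : ℕ}
    (hR : ∀ x y : ℤ → A, δ ≤ cantorDist β x y → ∃ l : ℤ, l.natAbs ≤ R ∧ x l ≠ y l)
    (v : ℕ) (r : ℤ) {x y : ℤ → A}
    (hx : ∀ n : ℤ, ¬ IsHole k h v (n + r) → x n = fixedSeq k h c (n + r))
    (hy : ∀ n : ℤ, ¬ IsHole k h v (n + r) → y n = fixedSeq k h c (n + r)) :
    upperDensity (separationTimes (cantorDist β) (shift A) δ x y) ≤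
      (2 * R + 1) * ((h : ℝ) / k) ^ v := by
  have hk : 0 < k := by omega
  have hcard : ((Finset.Icc (-(R : ℤ)) R ×ˢ holeResidues k h v).card : ℝ) =
      (2 * R + 1) * (h : ℝ) ^ v := by
    rw [Finset.card_product, card_holeResidues (by omega), Int.card_Icc]
    have : ((R : ℤ) + 1 - -R).toNat = 2 * R + 1 := by omega
    rw [this]
    push_cast
    ring
  have hle := upperDensity_le_of_subset (Finset.Icc (-(R : ℤ)) R ×ˢ holeResidues k h v)
    (fun p => p.2 - p.1 - r) (M := (k : ℤ) ^ v) (by positivity)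
    (E := separationTimes (cantorDist β) (shift A) δ x y) ?_
  · rw [hcard] at hle
    rw [div_pow, ← mul_div_assoc]
    simpa using hle
  · intro l hl
    obtain ⟨j, hj, hne⟩ := hR _ _ hl
    rw [shift_zpow_apply, shift_zpow_apply] at hne
    have hhole : IsHole k h v (j + l + r) := by
      by_contra hcon
      exact hne ((hx _ hcon).trans (hy _ hcon).symm)
    refine ⟨(j, (j + l + r) % (k : ℤ) ^ v), ?_, ?_⟩
    · rw [Finset.mem_product, Finset.mem_Icc, mem_holeResidues (by omega), isHole_emod hk]
      refine ⟨⟨by dsimp only; omega, by dsimp only; omega⟩, ⟨?_, ?_⟩, hhole⟩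
      · exact Int.emod_nonneg _ (by positivity)
      · exact Int.emod_lt_of_pos _ (by positivity)
    · have h1 : (j + l + r) % (k : ℤ) ^ v ≡ j + l + r [ZMOD (k : ℤ) ^ v] := Int.mod_modEq _ _
      have h2 := (h1.sub_right j).sub_right r
      rw [show j + l + r - j - r = l by ring] at h2
      exact h2.symm

/-- Sending a point to its residue modulo `k ^ v` is injective on a separated set. -/
theorem sepNumber_le (hhk : 2 * h < k) {δ : ℝ} {R : ℕ}
    (hR : ∀ x y : ℤ → A, δ ≤ cantorDist β x y → ∃ l : ℤ, l.natAbs ≤ R ∧ x l ≠ y l)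
    {ν : ℝ} (v : ℕ) (hν : (2 * R + 1) * ((h : ℝ) / k) ^ v < ν) :
    sepNumber (cantorDist β) (shift A) (substSystem (holeSubst k h c)) δ ν ≤ (k ^ v : ℕ) := by
  refine iSup_le ?_
  rintro ⟨S, hSX, hS⟩
  have hres : ∀ x : S, ∃ r ∈ Finset.range (k ^ v), ∀ n : ℤ, ¬ IsHole k h v (n + (r : ℕ)) →
      x.1 n = fixedSeq k h c (n + (r : ℕ)) := fun x => exists_residue hhk (hSX x.2) v
  choose f hf hf' using hres
  have hinj : Function.Injective fun x : S => (⟨f x, Finset.mem_range.1 (hf x)⟩ : Fin (k ^ v)) := by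
    intro x y hxy
    by_contra hne
    have hfxy : f x = f y := congrArg Fin.val hxy
    have h1 := hS x x.2 y y.2 fun h => hne (Subtype.ext h)
    have h2 := upperDensity_separationTimes_le hhk hR v (f x) (hf' x) (hfxy ▸ hf' y)
    linarith
  have h1 := ENat.card_le_card_of_injective hinj
  simpa [ENat.card_coe_set_eq] using h1

theorem le_upperDensity_separationTimes (hhk : 2 * h < k)
    (hc : ∀ j : ℤ, h < j → j < k → c j ≠ c 0) {u : ℕ} {i q : ℤ} (hq : ¬ (k : ℤ) ∣ q) :
    (h : ℝ) ^ u / k ^ (u + 1) ≤ upperDensity (separationTimes (cantorDist β) (shift A) 1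
      ((shift A ^ i) (fixedSeq k h c)) ((shift A ^ (i + (k : ℤ) ^ u * q)) (fixedSeq k h c))) := by
  have hk : 0 < k := by omega
  have hk' : (0 : ℤ) < k := by omega
  obtain ⟨p, hp⟩ : ∃ p : ℤ, ∀ m : ℤ, m % k = p % k →
      fixedSeq k h c m ≠ fixedSeq k h c (m + q) := by
    have hq0 : q % k ≠ 0 := fun h0 => hq (Int.dvd_of_emod_eq_zero h0)
    have hq1 := Int.emod_nonneg q hk'.ne'
    have hq2 := Int.emod_lt_of_pos q hk'
    -- The class is chosen so that one of `m`, `m + q` has residue `0` and the other a residue above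
    -- `h`. In the first case the latter is `k - q % k`, which exceeds `h` because `2 * h < k`.
    by_cases hqh : q % k ≤ h
    · refine ⟨-q, fun m hm => ?_⟩
      have h1 : (m + q) % k = 0 := by
        rw [Int.add_emod, hm, ← Int.add_emod]; simp
      have h2 : m % k = k - q % k := by
        have hm1 := Int.emod_nonneg m hk'.ne'
        have hm2 := Int.emod_lt_of_pos m hk'
        rw [Int.add_emod] at h1
        by_cases hlt : m % k + q % k < k
        · rw [Int.emod_eq_of_lt (by omega) hlt] at h1
          omega
        · rw [← Int.sub_emod_right, Int.emod_eq_of_lt (by omega) (by omega)] at h1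
          omega
      rw [fixedSeq_of_not_digit (by omega), fixedSeq_of_not_digit (by omega), h1, h2]
      exact hc _ (by omega) (by omega)
    · refine ⟨0, fun m hm => ?_⟩
      have h1 : m % k = 0 := by simpa using hm
      have h2 : (m + q) % k = q % k := by rw [Int.add_emod, h1]; simp
      rw [fixedSeq_of_not_digit (by omega), fixedSeq_of_not_digit (by omega), h1, h2]
      exact (hc _ (by omega) hq2).symm
  -- Each hole of level `u` whose quotient by `k ^ u` is congruent to `p` modulo `k` gives a
  -- separation time: `h ^ u` classes modulo `k ^ (u + 1)`.
  have hle := le_upperDensity_of_subset (holeResidues k h u)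
    (fun r => r + (k : ℤ) ^ u * p - i) (M := (k : ℤ) ^ (u + 1)) (by positivity) ?_
    (E := separationTimes (cantorDist β) (shift A) 1
      ((shift A ^ i) (fixedSeq k h c)) ((shift A ^ (i + (k : ℤ) ^ u * q)) (fixedSeq k h c))) ?_
  · rw [card_holeResidues (by omega)] at hle
    simpa using hle
  · intro r hr r' hr' hrr
    rw [mem_holeResidues (by omega)] at hr hr'
    have h1 : r ≡ r' [ZMOD (k : ℤ) ^ u] := by
      have := (hrr.add_right i).of_dvd (pow_dvd_pow (k : ℤ) u.le_succ)
      simpa using this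
    rwa [Int.ModEq, Int.emod_eq_of_lt hr.1.1 hr.1.2, Int.emod_eq_of_lt hr'.1.1 hr'.1.2] at h1
  · intro r hr l hl
    rw [mem_holeResidues (by omega)] at hr
    apply one_le_cantorDist
    simp only [shift_zpow_apply, zero_add]
    obtain ⟨t, ht⟩ := hl.symm.dvd
    have hli : l + i = r + (k : ℤ) ^ u * (p + k * t) := by
      rw [pow_succ] at ht
      linear_combination ht
    have hdiv : ∀ m : ℤ, (r + (k : ℤ) ^ u * m) / (k : ℤ) ^ u = m := by
      intro m
      rw [Int.add_mul_ediv_left _ _ (by positivity), Int.ediv_eq_zero_of_lt hr.1.1 hr.1.2, zero_add]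
    rw [← add_assoc, hli, add_assoc, ← mul_add,
      fixedSeq_of_isHole hhk u _ ((isHole_add_pow_mul hk u _ _).2 hr.2),
      fixedSeq_of_isHole hhk u _ ((isHole_add_pow_mul hk u _ _).2 hr.2), hdiv, hdiv]
    exact hp _ (by simp)

theorem le_sepNumber (hh : 1 ≤ h) (hhk : 2 * h < k) (hc : ∀ j : ℤ, h < j → j < k → c j ≠ c 0)
    {ν : ℝ} (v : ℕ) (hν : ν ≤ ((h : ℝ) / k) ^ v / k) :
    (k ^ v : ℕ) ≤
      sepNumber (cantorDist β) (shift A) (substSystem (holeSubst k h c)) 1 ν := by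
  have hk : 0 < k := by omega
  have hsep : ∀ i j : Fin (k ^ v), i < j → ((h : ℝ) / k) ^ v / k ≤
      upperDensity (separationTimes (cantorDist β) (shift A) 1
        ((shift A ^ ((i : ℕ) : ℤ)) (fixedSeq k h c))
        ((shift A ^ ((j : ℕ) : ℤ)) (fixedSeq k h c))) := by
    intro i j hij
    obtain ⟨d, hd⟩ := Nat.exists_eq_add_of_lt (Fin.lt_def.1 hij)
    -- Write `j - i = d + 1` as `k ^ u * q` with `k ∤ q`. As `j - i < k ^ v`, the level `u` is at
    -- most `v`.
    have hfin : FiniteMultiplicity k (d + 1) :=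
      Nat.finiteMultiplicity_iff.2 ⟨by omega, by omega⟩
    obtain ⟨q, hq, hkq⟩ := hfin.exists_eq_pow_mul_and_not_dvd
    generalize multiplicity k (d + 1) = u at hq
    have huv : u ≤ v := by
      have h1 : k ^ u ≤ d + 1 := Nat.le_of_dvd (by omega) ⟨q, hq⟩
      have h2 : k ^ u < k ^ v := by have := j.2; omega
      exact ((Nat.pow_lt_pow_iff_right (by omega)).1 h2).le
    have hj : ((j : ℕ) : ℤ) = (i : ℕ) + (k : ℤ) ^ u * (q : ℕ) := by
      rw [hd, add_assoc, hq]; push_cast; ring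
    rw [hj]
    refine le_trans ?_ (le_upperDensity_separationTimes hhk hc (by exact_mod_cast hkq))
    rw [pow_succ, ← div_div, ← div_pow]
    have hle : (h : ℝ) / k ≤ 1 :=
      div_le_one_of_le₀ (by exact_mod_cast (by omega : h ≤ k)) (by positivity)
    exact div_le_div_of_nonneg_right (pow_le_pow_of_le_one (by positivity) hle huv) (by positivity)
  have hsymm : ∀ x y : ℤ → A, separationTimes (cantorDist β) (shift A) 1 x y =
      separationTimes (cantorDist β) (shift A) 1 y x := by
    intro x y
    ext l
    simp only [separationTimes, Set.mem_ofPred_eq]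
    rw [cantorDist_comm]
  have hsep' : ∀ i j : Fin (k ^ v), i ≠ j → ((h : ℝ) / k) ^ v / k ≤
      upperDensity (separationTimes (cantorDist β) (shift A) 1
        ((shift A ^ ((i : ℕ) : ℤ)) (fixedSeq k h c))
        ((shift A ^ ((j : ℕ) : ℤ)) (fixedSeq k h c))) := by
    intro i j hij
    rcases lt_or_gt_of_ne hij with hlt | hlt
    · exact hsep i j hlt
    · rw [hsymm]; exact hsep j i hlt
  -- The translates are distinct because a point has no separation times from itself, whereas
  -- distinct indices give positive density.
  have hinj : Function.Injective fun i : Fin (k ^ v) =>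
      (shift A ^ ((i : ℕ) : ℤ)) (fixedSeq k h c) := by
    intro i j hij
    by_contra hne
    have h1 := hsep' i j hne
    dsimp only at hij
    rw [hij] at h1
    have h2 : separationTimes (cantorDist β) (shift A) 1
        ((shift A ^ ((j : ℕ) : ℤ)) (fixedSeq k h c))
        ((shift A ^ ((j : ℕ) : ℤ)) (fixedSeq k h c)) = ∅ := by
      ext l
      simp [separationTimes, cantorDist]
    rw [h2, upperDensity_empty] at h1
    have : 0 < ((h : ℝ) / k) ^ v / k := by positivity
    linarith
  have hmem : ∀ l : ℤ, (shift A ^ l) (fixedSeq k h c) ∈ substSystem (holeSubst k h c) := by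
    intro l i m
    have := fixedSeq_mem (c := c) hh hhk (i + l) m
    simpa [shift_zpow_apply, add_right_comm] using this
  have hcard : (Set.range fun i : Fin (k ^ v) =>
      (shift A ^ ((i : ℕ) : ℤ)) (fixedSeq k h c)).encard = (k ^ v : ℕ) := by
    rw [← Set.image_univ, hinj.encard_image, Set.encard_univ]
    simp
  rw [← hcard]
  refine le_iSup (fun S : {S : Set (ℤ → A) // S ⊆ substSystem (holeSubst k h c) ∧
    IsAsympSeparated (cantorDist β) (shift A) 1 ν S} => (S : Set (ℤ → A)).encard) ⟨_, ?_, ?_⟩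
  · rintro _ ⟨i, rfl⟩
    exact hmem _
  · rintro _ ⟨i, rfl⟩ _ ⟨j, rfl⟩ hne
    exact hν.trans (hsep' i j fun hij => hne (by rw [hij]))

end Separation

/-! ### The amorphic complexity and the choice of parameters -/

section AmorphicComplexity

open Filter Topology

variable {A : Type u} {β : ℝ} {k h : ℕ} {c : ℤ → A}

theorem log_natCast_div (n : ℕ) (hn : 0 < n) (t : ℝ) :
    ENNReal.log (((n : ℕ∞) : ENNReal)) / (t : EReal) = ((Real.log n / t : ℝ) : EReal) := by
  have h1 : (((n : ℕ∞) : ENNReal)) = ENNReal.ofReal (n : ℝ) := by simp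
  rw [h1, ENNReal.log_ofReal_of_pos (by exact_mod_cast hn), EReal.coe_div]

/-- Constant factors in the bounds on `ν` contribute `e`, and rounding `v` to an integer contributes
`f`. Both vanish against `-log ν`. -/
theorem tendsto_rate_bound (e f K L : ℝ) :
    Tendsto (fun ν : ℝ => ((((-Real.log ν + e) / L + f) * K / (-Real.log ν) : ℝ) : EReal))
      (𝓝[>] 0) (𝓝 ((K / L : ℝ) : EReal)) := by
  have hlog : Tendsto (fun ν : ℝ => -Real.log ν) (𝓝[>] 0) atTop :=
    tendsto_neg_atBot_atTop.comp Real.tendsto_log_nhdsGT_zero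
  have h2 := (hlog.inv_tendsto_atTop.const_mul ((e / L + f) * K)).const_add (K / L)
  rw [mul_zero, add_zero] at h2
  refine (continuous_coe_real_ereal.tendsto _).comp (h2.congr' ?_)
  filter_upwards [hlog.eventually_gt_atTop 0] with ν hν
  simp only [Pi.inv_apply]
  have : -Real.log ν ≠ 0 := hν.ne'
  generalize -Real.log ν = t at *
  field_simp
  ring

theorem eventually_mem_Ioo {b : ℝ} (hb : 0 < b) : ∀ᶠ ν : ℝ in 𝓝[>] 0, 0 < ν ∧ ν < b :=
  Ioo_mem_nhdsGT hb

theorem le_liminf_sepRate (hh : 1 ≤ h) (hhk : 2 * h < k)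
    (hc : ∀ j : ℤ, h < j → j < k → c j ≠ c 0) :
    ((Real.log k / (Real.log k - Real.log h) : ℝ) : EReal) ≤ liminf (fun ν : ℝ =>
      sepRate (cantorDist β) (shift A) (substSystem (holeSubst k h c)) 1 ν) (𝓝[>] 0) := by
  have hk : (0 : ℝ) < k := by exact_mod_cast (by omega : 0 < k)
  have hh0 : (0 : ℝ) < h := by exact_mod_cast hh
  have hL : 0 < Real.log k - Real.log h :=
    sub_pos.2 (Real.log_lt_log hh0 (by exact_mod_cast (by omega : h < k)))
  have hK : 0 < Real.log k := Real.log_pos (by exact_mod_cast (by omega : 1 < k))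
  rw [← (tendsto_rate_bound (-Real.log k) (-1) (Real.log k) (Real.log k - Real.log h)).liminf_eq]
  refine liminf_le_liminf ?_
  filter_upwards [eventually_mem_Ioo (b := (k : ℝ)⁻¹) (by positivity),
    eventually_mem_Ioo one_pos] with ν hν hν1
  have hlogν : 0 < -Real.log ν := neg_pos.2 (Real.log_neg hν1.1 hν1.2)
  have hnum : 0 ≤ -Real.log ν + -Real.log k := by
    have := Real.log_le_log hν.1 hν.2.le
    rw [Real.log_inv] at this
    linarith
  -- The largest `v` with `ν ≤ (h / k) ^ v / k`.
  set v := ⌊(-Real.log ν + -Real.log k) / (Real.log k - Real.log h)⌋₊ with hv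
  have hv1 : (v : ℝ) * (Real.log k - Real.log h) ≤ -Real.log ν + -Real.log k :=
    (le_div_iff₀ hL).1 (Nat.floor_le (by positivity))
  have hv2 := (Nat.lt_floor_add_one
    ((-Real.log ν + -Real.log k) / (Real.log k - Real.log h))).le
  rw [← hv] at hv2
  have hνv : ν ≤ ((h : ℝ) / k) ^ v / k := by
    rw [← Real.log_le_log_iff hν.1 (by positivity), Real.log_div (by positivity) (by positivity),
      Real.log_pow, Real.log_div (by positivity) (by positivity)]
    linarith
  have hsep := le_sepNumber (β := β) hh hhk hc v hνv
  rw [sepRate]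
  calc (((((-Real.log ν + -Real.log k) / (Real.log k - Real.log h) + -1) * Real.log k /
        (-Real.log ν) : ℝ)) : EReal)
      ≤ ((Real.log (k ^ v : ℕ) / (-Real.log ν) : ℝ) : EReal) := by
        rw [EReal.coe_le_coe_iff]
        push_cast
        rw [Real.log_pow]
        gcongr
        linarith
    _ = ENNReal.log ((((k ^ v : ℕ) : ℕ∞) : ENNReal)) / ((-Real.log ν : ℝ) : EReal) :=
        (log_natCast_div _ (Nat.pow_pos (by omega)) _).symm
    _ ≤ _ := EReal.div_le_div_right_of_nonneg (by exact_mod_cast hlogν.le)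
        (ENNReal.log_monotone (ENat.toENNReal_le.2 hsep))

theorem limsup_sepRate_le (hβ : 1 < β) (hh : 1 ≤ h) (hhk : 2 * h < k) {δ : ℝ} (hδ : 0 < δ) :
    limsup (fun ν : ℝ =>
      sepRate (cantorDist β) (shift A) (substSystem (holeSubst k h c)) δ ν) (𝓝[>] 0) ≤
      ((Real.log k / (Real.log k - Real.log h) : ℝ) : EReal) := by
  obtain ⟨R, hR⟩ := exists_radius (A := A) hβ hδ
  have hk : (0 : ℝ) < k := by exact_mod_cast (by omega : 0 < k)
  have hh0 : (0 : ℝ) < h := by exact_mod_cast hh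
  have hL : 0 < Real.log k - Real.log h :=
    sub_pos.2 (Real.log_lt_log hh0 (by exact_mod_cast (by omega : h < k)))
  have hK : 0 < Real.log k := Real.log_pos (by exact_mod_cast (by omega : 1 < k))
  have hR0 : 0 ≤ Real.log (2 * R + 1) := Real.log_nonneg (by linarith [R.cast_nonneg (α := ℝ)])
  rw [← (tendsto_rate_bound (Real.log (2 * R + 1)) 1 (Real.log k)
    (Real.log k - Real.log h)).limsup_eq]
  refine limsup_le_limsup ?_
  filter_upwards [eventually_mem_Ioo one_pos] with ν hν
  have hlogν : 0 < -Real.log ν := neg_pos.2 (Real.log_neg hν.1 hν.2)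
  -- The least positive `v` with `(2 * R + 1) * (h / k) ^ v < ν`; the `+ 1` makes the inequality
  -- strict.
  set v := ⌊(-Real.log ν + Real.log (2 * R + 1)) / (Real.log k - Real.log h)⌋₊ + 1 with hv
  have hv1 : (v : ℝ) ≤ (-Real.log ν + Real.log (2 * R + 1)) / (Real.log k - Real.log h) + 1 := by
    rw [hv, Nat.cast_add, Nat.cast_one]
    gcongr
    exact Nat.floor_le (by positivity)
  have hv2 : -Real.log ν + Real.log (2 * R + 1) < v * (Real.log k - Real.log h) := by
    rw [← div_lt_iff₀ hL, hv, Nat.cast_add, Nat.cast_one]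
    exact Nat.lt_floor_add_one _
  have hνv : (2 * R + 1) * ((h : ℝ) / k) ^ v < ν := by
    rw [← Real.log_lt_log_iff (by positivity) hν.1, Real.log_mul (by positivity) (by positivity),
      Real.log_pow, Real.log_div (by positivity) (by positivity)]
    linarith
  have hsep := sepNumber_le (c := c) hhk hR v hνv
  rw [sepRate]
  calc _ ≤ ENNReal.log ((((k ^ v : ℕ) : ℕ∞) : ENNReal)) / ((-Real.log ν : ℝ) : EReal) :=
        EReal.div_le_div_right_of_nonneg (by exact_mod_cast hlogν.le)
          (ENNReal.log_monotone (ENat.toENNReal_le.2 hsep))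
    _ = ((Real.log (k ^ v : ℕ) / (-Real.log ν) : ℝ) : EReal) :=
        log_natCast_div _ (Nat.pow_pos (by omega)) _
    _ ≤ _ := by
        rw [EReal.coe_le_coe_iff]
        push_cast
        rw [Real.log_pow]
        gcongr

theorem hasAC_holeSubst (hβ : 1 < β) (hh : 1 ≤ h) (hhk : 2 * h < k)
    (hc : ∀ j : ℤ, h < j → j < k → c j ≠ c 0) :
    HasAC (cantorDist β) (shift A) (substSystem (holeSubst k h c))
      ((Real.log k / (Real.log k - Real.log h) : ℝ) : EReal) := by
  have hlow : ((Real.log k / (Real.log k - Real.log h) : ℝ) : EReal) ≤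
      lowerAC (cantorDist β) (shift A) (substSystem (holeSubst k h c)) :=
    (le_liminf_sepRate hh hhk hc).trans (le_iSup (fun δ : {δ : ℝ // 0 < δ} => liminf (fun ν : ℝ =>
      sepRate (cantorDist β) (shift A) (substSystem (holeSubst k h c)) δ ν) (𝓝[>] 0)) ⟨1, one_pos⟩)
  have hupp : upperAC (cantorDist β) (shift A) (substSystem (holeSubst k h c)) ≤
      ((Real.log k / (Real.log k - Real.log h) : ℝ) : EReal) :=
    iSup_le fun δ => limsup_sepRate_le hβ hh hhk δ.2
  have hle : lowerAC (cantorDist β) (shift A) (substSystem (holeSubst k h c)) ≤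
      upperAC (cantorDist β) (shift A) (substSystem (holeSubst k h c)) :=
    iSup_mono fun δ => liminf_le_limsup
  exact ⟨(hle.trans hupp).antisymm hlow, hupp.antisymm (hlow.trans hle)⟩

/-- The incidence matrix is already positive: the prescribed letters occur in every image and
exhaust the alphabet. -/
theorem isPrimitiveSubst_holeSubst [Fintype A] [DecidableEq A]
    (hc : ∀ a, ∃ j : ℤ, 0 ≤ j ∧ j < k ∧ ¬ (1 ≤ j ∧ j ≤ h) ∧ c j = a) :
    IsPrimitiveSubst (holeSubst k h c) := by
  refine ⟨fun a b => by simp [incidenceMatrix], 1, one_pos, fun a b => ?_⟩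
  rw [pow_one]
  obtain ⟨j, hj0, hjk, hj, rfl⟩ := hc a
  lift j to ℕ using hj0
  simp only [incidenceMatrix, Matrix.of_apply, Nat.cast_pos, List.count_pos_iff, holeSubst,
    List.mem_ofFn]
  refine ⟨⟨j, by exact_mod_cast hjk⟩, ?_⟩
  rw [if_neg (by exact_mod_cast hj)]

/-- A choice of the determined letters: `c 0` occurs only once and every letter occurs. -/
theorem exists_letters [Fintype A] (hA : 2 ≤ Fintype.card A) (hk : h + Fintype.card A ≤ k) :
    ∃ c : ℤ → A, (∀ j : ℤ, h < j → j < k → c j ≠ c 0) ∧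
      ∀ a, ∃ j : ℤ, 0 ≤ j ∧ j < k ∧ ¬ (1 ≤ j ∧ j ≤ h) ∧ c j = a := by
  obtain ⟨m, hm⟩ := Nat.exists_eq_add_of_le hA
  let e : A ≃ Fin (m + 2) := Fintype.equivFinOfCardEq (by omega)
  -- The letters `1, …, m + 1` sit right after the copying positions. The default `1` is nonzero, so
  -- letter `0` stays confined to position `0`.
  let g : ℤ → Fin (m + 2) := fun j =>
    if j = 0 then 0 else if hj : h < j ∧ j - h < m + 2 then ⟨(j - h).toNat, by omega⟩ else 1
  refine ⟨fun j => e.symm (g j), fun j hj hjk heq => ?_, fun a => ?_⟩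
  · have h1 : g j = g 0 := e.symm.injective heq
    have h0 : g 0 = 0 := if_pos rfl
    rw [h0] at h1
    simp only [g] at h1
    rw [if_neg (by omega)] at h1
    split_ifs at h1 with h2
    · have := congrArg Fin.val h1
      simp at this
      omega
    · simp at h1
  · obtain ⟨i, rfl⟩ := e.symm.surjective a
    by_cases hi : i = 0
    · exact ⟨0, le_rfl, by omega, by omega, by simp [g, hi]⟩
    · have hi0 : 0 < (i : ℕ) := Nat.pos_of_ne_zero fun h => hi (Fin.ext h)
      have hi1 := i.2
      refine ⟨h + (i : ℕ), by omega, by omega, by omega, ?_⟩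
      simp only [g]
      rw [if_neg (by omega), dif_pos (by omega)]
      congr 1
      ext
      simp

/-- For `h = ⌈k ^ θ⌉` the ratio `log h / log k` tends to `θ`, so the quotient tends to `1 / (1 -
θ)`, which is `s` for `θ = 1 - 1 / s`. -/
theorem exists_parameters {s ε : ℝ} (hs : 1 ≤ s) (hε : 0 < ε) (m : ℕ) :
    ∃ k h : ℕ, 1 ≤ h ∧ 2 * h < k ∧ h + m ≤ k ∧
      |Real.log k / (Real.log k - Real.log h) - s| < ε := by
  have hs0 : 0 < s := by linarith
  set θ : ℝ := 1 - 1 / s with hθ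
  have hθ0 : 0 ≤ θ := sub_nonneg.2 ((div_le_one hs0).2 hs)
  have hθ1 : 0 < 1 - θ := by rw [hθ]; ring_nf; positivity
  have hcast : Tendsto (fun k : ℕ => (k : ℝ)) atTop atTop := tendsto_natCast_atTop_atTop
  have hbound : ∀ k : ℕ, 1 ≤ k → (k : ℝ) ^ θ ≤ ⌈(k : ℝ) ^ θ⌉₊ ∧
      (⌈(k : ℝ) ^ θ⌉₊ : ℝ) ≤ 2 * (k : ℝ) ^ θ := by
    intro k hk
    have h1 : 1 ≤ (k : ℝ) ^ θ := Real.one_le_rpow (by exact_mod_cast hk) hθ0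
    exact ⟨Nat.le_ceil _, by linarith [Nat.ceil_lt_add_one (a := (k : ℝ) ^ θ) (by positivity)]⟩
  have hlogtop : Tendsto (fun k : ℕ => Real.log k) atTop atTop := Real.tendsto_log_atTop.comp hcast
  have hratio : Tendsto (fun k : ℕ => Real.log ⌈(k : ℝ) ^ θ⌉₊ / Real.log k) atTop (𝓝 θ) := by
    have hup : Tendsto (fun k : ℕ => θ + Real.log 2 * (Real.log k)⁻¹) atTop (𝓝 θ) := by
      simpa using (hlogtop.inv_tendsto_atTop.const_mul (Real.log 2)).const_add θ
    refine tendsto_of_tendsto_of_tendsto_of_le_of_le' tendsto_const_nhds hup ?_ ?_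
    all_goals
      filter_upwards [eventually_ge_atTop 1, hlogtop.eventually_gt_atTop 0] with k hk hlog
      obtain ⟨h1, h2⟩ := hbound k hk
      have hk0 : (0 : ℝ) < k := by exact_mod_cast hk
      have hpow : 0 < (k : ℝ) ^ θ := by positivity
    · rw [le_div_iff₀ hlog, ← Real.log_rpow hk0]
      exact Real.log_le_log hpow h1
    · rw [div_le_iff₀ hlog, add_mul, mul_assoc, inv_mul_cancel₀ hlog.ne', mul_one,
        ← Real.log_rpow hk0, add_comm, ← Real.log_mul two_ne_zero hpow.ne']
      exact Real.log_le_log (hpow.trans_le h1) h2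
  have hlim : Tendsto (fun k : ℕ => Real.log k / (Real.log k - Real.log ⌈(k : ℝ) ^ θ⌉₊)) atTop
      (𝓝 s) := by
    have h1 := (hratio.const_sub 1).inv₀ hθ1.ne'
    have h2 : (1 - θ)⁻¹ = s := by rw [hθ]; simp
    rw [h2] at h1
    refine h1.congr' ?_
    filter_upwards [hlogtop.eventually_gt_atTop 0] with k hlog
    rw [one_sub_div hlog.ne', inv_div]
  -- As `⌈k ^ θ⌉ ≤ 2 * k ^ θ`, it is enough that `k ^ (1 - θ) > 4`, which holds eventually because
  -- `θ < 1`.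
  have hsmall : ∀ᶠ k : ℕ in atTop, 2 * ⌈(k : ℝ) ^ θ⌉₊ < k := by
    have h1 : Tendsto (fun k : ℕ => (k : ℝ) ^ (1 - θ)) atTop atTop :=
      (tendsto_rpow_atTop hθ1).comp hcast
    filter_upwards [h1.eventually_gt_atTop 4, eventually_ge_atTop 1] with k hk4 hk
    have hk0 : (0 : ℝ) < k := by exact_mod_cast hk
    have hpow : 0 < (k : ℝ) ^ θ := by positivity
    have h2 : (k : ℝ) = (k : ℝ) ^ (1 - θ) * (k : ℝ) ^ θ := by
      rw [← Real.rpow_add hk0]; simp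
    have h3 : (2 : ℝ) * ⌈(k : ℝ) ^ θ⌉₊ < k := by
      have := mul_lt_mul_of_pos_right hk4 hpow
      linarith [(hbound k hk).2]
    exact_mod_cast h3
  obtain ⟨k, hk1, hk2, hk3, hk4⟩ := ((Metric.tendsto_nhds.1 hlim ε hε).and
    (hsmall.and ((eventually_ge_atTop 1).and (eventually_ge_atTop (2 * m))))).exists
  refine ⟨k, ⌈(k : ℝ) ^ θ⌉₊, ?_, hk2, by omega, hk1⟩
  exact Nat.ceil_pos.2 (by positivity)

theorem dense_of_forall_holeSubst [Fintype A] (hA : 2 ≤ Fintype.card A) {P : ℝ → Prop}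
    (hP : ∀ (k h : ℕ) (c : ℤ → A), 1 ≤ h → 2 * h < k →
      (∀ j : ℤ, h < j → j < k → c j ≠ c 0) →
      (∀ a, ∃ j : ℤ, 0 ≤ j ∧ j < k ∧ ¬ (1 ≤ j ∧ j ≤ h) ∧ c j = a) →
      P (Real.log k / (Real.log k - Real.log h))) :
    Dense {s : Set.Ici (1 : ℝ) | P s} := by
  rw [Metric.dense_iff]
  rintro ⟨s, hs⟩ ε hε
  obtain ⟨k, h, hh, hhk, hm, hlt⟩ := exists_parameters hs hε (Fintype.card A)
  obtain ⟨c, hc0, hc⟩ := exists_letters hA hm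
  have hh0 : (0 : ℝ) < h := by exact_mod_cast hh
  have hlog : Real.log h < Real.log k :=
    Real.log_lt_log hh0 (by exact_mod_cast (by omega : h < k))
  have hlogh : 0 ≤ Real.log h := Real.log_natCast_nonneg h
  refine ⟨⟨Real.log k / (Real.log k - Real.log h), ?_⟩, hlt, hP k h c hh hhk hc0 hc⟩
  rw [Set.mem_Ici, one_le_div (sub_pos.2 hlog)]
  linarith

end AmorphicComplexity

end

theorem mainTheorem6 {A : Type u} [Fintype A] [DecidableEq A] [TopologicalSpace A]
    [DiscreteTopology A] (hA : 2 ≤ Fintype.card A) (β : ℝ) (hβ : 1 < β) :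
    -- minimal automatic systems over `A`
    Dense {s : Set.Ici (1 : ℝ) | ∃ X : Set (ℤ → A), IsMinimalSubshift X ∧ IsAutomaticSystem X ∧
      HasAC (cantorDist β) (shift A) X ((s : ℝ) : EReal)} ∧
    -- those of the form `X_φ` with `φ` a primitive substitution of constant length over `A`
    Dense {s : Set.Ici (1 : ℝ) | ∃ (k : ℕ) (φ : A → List A), 2 ≤ k ∧ IsConstantLength φ k ∧
      IsPrimitiveSubst φ ∧
      HasAC (cantorDist β) (shift A) (substSystem φ) ((s : ℝ) : EReal)} := by
  constructor
  · refine dense_of_forall_holeSubst hA (P := fun s => ∃ X : Set (ℤ → A), IsMinimalSubshift X ∧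
      IsAutomaticSystem X ∧ HasAC (cantorDist β) (shift A) X (s : EReal))
      fun k h c hh hhk hc0 hc => ?_
    refine ⟨_, isMinimalSubshift_holeSubst hh hhk hc,
      ⟨A, inferInstance, k, holeSubst k h c, id, by omega, fun a => by simp [holeSubst], ?_⟩,
      hasAC_holeSubst hβ hh hhk hc0⟩
    simp
  · refine dense_of_forall_holeSubst hA (P := fun s => ∃ (k : ℕ) (φ : A → List A), 2 ≤ k ∧
      IsConstantLength φ k ∧ IsPrimitiveSubst φ ∧
      HasAC (cantorDist β) (shift A) (substSystem φ) (s : EReal))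
      fun k h c hh hhk hc0 hc => ?_
    exact ⟨k, holeSubst k h c, by omega, fun a => by simp [holeSubst],
      isPrimitiveSubst_holeSubst hc, hasAC_holeSubst hβ hh hhk hc0⟩
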